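/- The class of chordal bipartite graphs has unbounded sim-width; that is, for every $k\in\mathbb{N}$ there is a finite simple chordal bipartite graph $G$ with $\mathrm{simw}(G)>k$. Here a bipartite graph is *chordal bipartite* if every induced cycle in it has exactly four vertices. A *branch decomposition* for a graph $G$ is a pair $(T,\delta)$, where $T$ is a finite tree of maximum degree at most $3$ and $\delta$ is a bijection from $V(G)$ to the leaves of $T$ (the vertex of a one-vertex tree counts as a leaf). Each edge $e$ of $T$ induces a partition $(A_e,\overline{A_e})$ of $V(G)$ according to the component of $T-e$ that contains $\delta(v)$. Let $\mathrm{cutsim}_G(A_e,\overline{A_e})$ be the maximum size of a set $M$ of edges of $G$, each with one end in $A_e$ and the other in $\overline{A_e}$, such that distinct edges of $M$ share no endpoint and $G$ has no edge between endpoints of distinct edges of $M$. The sim-width of $(T,\delta)$ is the maximum of $\mathrm{cutsim}_G(A_e,\overline{A_e})$ over all edges $e$ of $T$ ($0$ if $T$ has no edge), and $\mathrm{simw}(G)$ is the minimum sim-width over all branch decompositions for $G$ ($0$ if $G$ has no vertex). -/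

import Mathlib

noncomputable section

namespace SimWidth

open SimpleGraph

variable {V : Type*}

/-- A bipartite graph is chordal bipartite if every induced cycle in it has exactly four vertices. -/
def IsChordalBipartite (G : SimpleGraph V) : Prop :=
  G.IsBipartite ∧ ∀ n : ℕ, 3 ≤ n → (cycleGraph n).IsIndContained G → n = 4

/-- A set `M` of edges of `G` is an induced matching of `G` if distinct edges of `M` share no
endpoint and no edge of `G` joins endpoints of distinct edges of `M`. -/
def IsInducedMatching (G : SimpleGraph V) (M : Finset (Sym2 V)) : Prop :=
  (∀ e ∈ M, e ∈ G.edgeSet) ∧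
    ∀ e ∈ M, ∀ f ∈ M, e ≠ f → ∀ x ∈ e, ∀ y ∈ f, x ≠ y ∧ ¬ G.Adj x y

/-- Every edge of `M` has one endpoint in `A` and the other one in the complement of `A`. -/
def Crosses (M : Finset (Sym2 V)) (A : Set V) : Prop :=
  ∀ e ∈ M, ∃ a b : V, a ∈ A ∧ b ∉ A ∧ e = s(a, b)

/-- The largest size of an induced matching of `G` (induced in `G`, not only in the bipartite graph
between `A` and its complement) all of whose edges cross the cut `(A, Aᶜ)`. -/
def cutSim (G : SimpleGraph V) (A : Set V) : ℕ :=
  sSup {m : ℕ | ∃ M : Finset (Sym2 V), IsInducedMatching G M ∧ Crosses M A ∧ M.card = m}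

/-- A leaf of a tree. The vertex of the one-vertex tree counts as a leaf. -/
def IsLeaf {N : Type*} (T : SimpleGraph N) (t : N) : Prop :=
  (T.neighborSet t).ncard ≤ 1

/-- A branch decomposition for a graph with vertex set `V`: a finite tree of maximum degree at most
three together with a bijection from `V` to the leaves of the tree. -/
structure BranchDecomposition (V : Type*) where
  Node : Type
  finite_node : Finite Node
  tree : SimpleGraph Node
  isTree : tree.IsTree
  subcubic : ∀ t : Node, (tree.neighborSet t).ncard ≤ 3
  leafEquiv : V ≃ {t : Node // IsLeaf tree t}

/-- For an edge `uv` of the tree, the set of vertices of the graph whose leaf lies in the component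
of `u` after deletion of the edge `uv`. -/
def BranchDecomposition.side (D : BranchDecomposition V) (u v : D.Node) : Set V :=
  {x : V | (D.tree.deleteEdges {s(u, v)}).Reachable u (D.leafEquiv x : D.Node)}

/-- The sim-width of a branch decomposition for `G`: the maximum of `cutSim` over the edges of the
tree (zero if the tree has no edge). -/
def BranchDecomposition.simWidth (D : BranchDecomposition V) (G : SimpleGraph V) : ℕ :=
  sSup {w : ℕ | ∃ u v : D.Node, D.tree.Adj u v ∧ cutSim G (D.side u v) = w}

/-- The sim-width of a graph: the minimum sim-width of a branch decomposition (zero for the graph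
without vertices, which has no branch decomposition). -/
def simWidth (G : SimpleGraph V) : ℕ :=
  sInf {w : ℕ | ∃ D : BranchDecomposition V, D.simWidth G = w}

end SimWidth

end

/-! Attach to every edge `a i`–`b j` of `K_{n,n}` an ear `a i, q i j, p i j, b j`. An induced cycle
through an ear vertex can only be the 4-cycle closed by that ear, and the other induced cycles lie
in `K_{n,n}`, so the graph is chordal bipartite (`isChordalBipartite_earGraph`).

Let a cut have `cutSim` at most `k`. The edges `a i`–`q i j` with one `j` per row, the edges `b
j`–`p i j` with one `i` per column, and all edges `q i j`–`p i j` are induced matchings, so at most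
`k` rows, `k` columns and `k` ears are split. If two unsplit columns had their `b` on opposite
sides, every unsplit row would contain a split ear, forcing `n ≤ 2 * k`. Hence one side contains
vertices `p i j` from split columns only, at most `k * n` of them
(`ncard_inter_innerVertices_le_or`). But every branch decomposition has an edge whose cut divides
the `n * n` vertices `p i j` more evenly than that (`BranchDecomposition.exists_balanced`). -/

namespace SimWidth

open SimpleGraph

/-! ### Edges of trees that split a weight evenly -/

section Tree

variable {N : Type*} {T : SimpleGraph N}

/-- The component of `u` after deletion of the edge `uv`. -/
def branch (T : SimpleGraph N) (u v : N) : Set N :=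
  {x | (T.deleteEdges {s(u, v)}).Reachable u x}

theorem mem_branch_self (u v : N) : u ∈ branch T u v := Reachable.refl u

theorem mem_branch_step {u v x y : N} (hx : x ∈ branch T u v) (hxy : T.Adj x y)
    (hne : s(x, y) ≠ s(u, v)) : y ∈ branch T u v :=
  Reachable.trans hx (Adj.reachable (by simpa [deleteEdges_adj] using ⟨hxy, by simpa using hne⟩))

theorem mem_branch_or (hT : T.IsTree) (u v x : N) :
    x ∈ branch T u v ∨ x ∈ branch T v u := by
  obtain ⟨w⟩ := hT.connected u x
  have key : ∀ {y z : N}, T.Walk y z → (y ∈ branch T u v ∨ y ∈ branch T v u) →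
      (z ∈ branch T u v ∨ z ∈ branch T v u) := by
    intro y z w
    induction w with
    | nil => exact id
    | @cons a b c hab _ ih =>
      intro h
      apply ih
      by_cases he : s(a, b) = s(u, v)
      · rcases Sym2.eq_iff.1 he with ⟨-, rfl⟩ | ⟨-, rfl⟩
        · exact Or.inr (mem_branch_self _ _)
        · exact Or.inl (mem_branch_self _ _)
      · rcases h with h | h
        · exact Or.inl (mem_branch_step h hab he)
        · exact Or.inr (mem_branch_step h hab (by rwa [Sym2.eq_swap (a := v)]))
  exact key w (Or.inl (mem_branch_self _ _))

theorem not_mem_branch (hT : T.IsTree) {u v : N} (huv : T.Adj u v) :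
    v ∉ branch T u v :=
  isBridge_iff.1 (isAcyclic_iff_forall_adj_isBridge.1 hT.isAcyclic huv)

theorem not_mem_branch_swap (hT : T.IsTree) {u v x : N} (huv : T.Adj u v)
    (hx : x ∈ branch T u v) : x ∉ branch T v u := by
  intro hx'
  refine not_mem_branch hT huv (Reachable.trans hx ?_)
  have : (T.deleteEdges {s(v, u)}).Reachable v x := hx'
  rw [Sym2.eq_swap] at this
  exact this.symm

theorem compl_branch (hT : T.IsTree) {u v : N} (huv : T.Adj u v) :
    (branch T u v)ᶜ = branch T v u := by
  ext x
  constructor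
  · exact (mem_branch_or hT u v x).resolve_left
  · exact not_mem_branch_swap hT huv.symm

theorem exists_adj_mem_branch (hT : T.IsTree) {v x : N} (hx : x ≠ v) :
    ∃ w, T.Adj v w ∧ x ∈ branch T w v := by
  obtain ⟨p, hp, -⟩ := hT.existsUnique_path v x
  cases p with
  | nil => exact absurd rfl hx
  | @cons _ w _ h q =>
    refine ⟨w, h, ?_⟩
    -- A path leaves its start `v` for good, so its tail avoids the deleted edge.
    have hv : v ∉ q.support := ((Walk.cons_isPath_iff h q).1 hp).2
    refine ⟨q.toDeleteEdge s(w, v) fun he => hv ?_⟩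
    exact q.snd_mem_support_of_mem_edges he

/-- A walk from `w` avoiding the edge `wv` never reaches `v`, hence never uses `uv`. The inclusion
is strict because of `v` itself. This is the descent step in `BranchDecomposition.exists_balanced`.
-/
theorem branch_ssubset (hT : T.IsTree) {u v w : N} (huv : T.Adj u v) (hvw : T.Adj v w)
    (hwu : w ≠ u) : branch T w v ⊂ branch T v u := by
  refine ⟨?_, fun h => not_mem_branch hT hvw.symm (h (mem_branch_self v u))⟩
  rintro x ⟨p⟩
  have key : ∀ {y z : N}, (T.deleteEdges {s(w, v)}).Walk y z → y ∈ branch T w v →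
      y ∈ branch T v u → z ∈ branch T v u := by
    intro y z p
    induction p with
    | nil => exact fun _ h => h
    | @cons a b c hab _ ih =>
      intro ha ha'
      have hb : b ∈ branch T w v := Reachable.trans ha hab.reachable
      have hne : ∀ {d}, d ∈ branch T w v → d ≠ v := by
        rintro d hd rfl
        exact not_mem_branch hT hvw.symm hd
      refine ih hb (mem_branch_step ha' (deleteEdges_le _ hab) ?_)
      intro he
      rcases Sym2.eq_iff.1 he with ⟨h, -⟩ | ⟨-, h⟩
      · exact hne ha h
      · exact hne hb h
  refine key p (mem_branch_self _ _) (mem_branch_step (mem_branch_self v u) hvw ?_)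
  intro he
  rcases Sym2.eq_iff.1 he with ⟨-, h⟩ | ⟨h, -⟩
  · exact hwu h
  · exact huv.ne h.symm

end Tree

variable {V : Type*}

theorem BranchDecomposition.compl_side (D : BranchDecomposition V) {u v : D.Node}
    (huv : D.tree.Adj u v) : (D.side u v)ᶜ = D.side v u :=
  congrArg (fun s : Set D.Node => (fun x => (D.leafEquiv x : D.Node)) ⁻¹' s)
    (compl_branch D.isTree huv)

/-- If `P` has more than `3 * c + 1` elements, then some edge of the tree has more than `c`
elements of `P` on either side. -/
theorem BranchDecomposition.exists_balanced [Finite V] (D : BranchDecomposition V) {P : Set V}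
    {c : ℕ} (hP : 3 * c + 1 < P.ncard) :
    ∃ u v, D.tree.Adj u v ∧ c < (D.side u v ∩ P).ncard ∧ c < ((D.side u v)ᶜ ∩ P).ncard := by
  by_contra! hcon
  have := D.finite_node
  have hT := D.isTree
  have hsmall : ∀ u v, D.tree.Adj u v → c < (D.side u v ∩ P).ncard →
      (D.side v u ∩ P).ncard ≤ c := fun u v h hc => by
    rw [← D.compl_side h]; exact hcon u v h hc
  have hcover : ∀ v (x : V), (D.leafEquiv x : D.Node) ≠ v →
      ∃ w, D.tree.Adj v w ∧ x ∈ D.side w v := fun v x hx => exists_adj_mem_branch hT hx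
  -- Beyond the edge at a leaf lies all of `P` except at most one element; the `+ 1` in `hP` makes
  -- this exceed `c` even when `c = 0`.
  have hleaf : ∀ v u, D.tree.Adj v u → ((D.tree.neighborSet v).ncard ≤ 1) →
      c < (D.side u v ∩ P).ncard := by
    intro v u hvu hv
    by_contra! hle
    have hsub : P ⊆ (D.side u v ∩ P) ∪ {D.leafEquiv.symm ⟨v, hv⟩} := by
      intro x hx
      by_cases hxv : (D.leafEquiv x : D.Node) = v
      · right
        simp [← hxv]
      · obtain ⟨w, hw, hxw⟩ := hcover v x hxv
        have : w = u := (Set.ncard_le_one).1 hv w hw u hvu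
        exact Or.inl ⟨this ▸ hxw, hx⟩
    have h1 := Set.ncard_le_ncard hsub
    have h2 := Set.ncard_union_le (D.side u v ∩ P) {D.leafEquiv.symm ⟨v, hv⟩}
    rw [Set.ncard_singleton] at h2
    omega
  -- An inner node carries no graph vertex, so its at most three branches cover `P` and cannot all
  -- have at most `c` elements of it.
  have hinner : ∀ v, ¬ (D.tree.neighborSet v).ncard ≤ 1 →
      ∃ w, D.tree.Adj v w ∧ c < (D.side w v ∩ P).ncard := by
    intro v hv
    by_contra! hle
    have hsub : P ⊆ ⋃ w ∈ (D.tree.neighborSet v).toFinite.toFinset, D.side w v ∩ P := by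
      intro x hx
      have hxv : (D.leafEquiv x : D.Node) ≠ v := by
        intro h
        have := (D.leafEquiv x).2
        rw [h] at this
        exact hv this
      obtain ⟨w, hw, hxw⟩ := hcover v x hxv
      simp only [Set.mem_iUnion]
      exact ⟨w, by simpa using hw, hxw, hx⟩
    have h1 := Set.ncard_le_ncard hsub
    have h2 := Finset.set_ncard_biUnion_le (D.tree.neighborSet v).toFinite.toFinset
      (fun w => D.side w v ∩ P)
    have h3 := Finset.sum_le_card_nsmul (D.tree.neighborSet v).toFinite.toFinset
      (fun w => (D.side w v ∩ P).ncard) c (fun w hw => hle w (by simpa using hw))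
    have h4 := D.subcubic v
    rw [Set.ncard_eq_toFinset_card _ (D.tree.neighborSet v).toFinite] at h4
    have h5 := Nat.mul_le_mul_right c h4
    rw [smul_eq_mul] at h3
    omega
  -- a heavy branch of minimal size
  have hne : ∃ m, ∃ u v, D.tree.Adj u v ∧ c < (D.side v u ∩ P).ncard ∧
      (branch D.tree v u).ncard = m := by
    obtain ⟨v⟩ := hT.connected.nonempty
    by_cases hv : (D.tree.neighborSet v).ncard ≤ 1
    · obtain ⟨x, hx, hxv⟩ := Set.exists_ne_of_one_lt_ncard (s := P) (by omega)
        (D.leafEquiv.symm ⟨v, hv⟩)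
      obtain ⟨w, hw, -⟩ := hcover v x (by
        intro h
        apply hxv
        simp [← h])
      exact ⟨_, v, w, hw, hleaf v w hw hv, rfl⟩
    · obtain ⟨w, hw, h⟩ := hinner v hv
      exact ⟨_, v, w, hw, h, rfl⟩
  classical
  obtain ⟨u, v, huv, hc, hm⟩ := Nat.find_spec hne
  have hmin := fun m (h : m < Nat.find hne) => Nat.find_min hne h
  have hu := hsmall v u huv.symm hc
  by_cases hv : (D.tree.neighborSet v).ncard ≤ 1
  · exact absurd (hleaf v u huv.symm hv) (by omega)
  · obtain ⟨w, hw, h⟩ := hinner v hv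
    have hwu : w ≠ u := by
      rintro rfl
      omega
    refine hmin (branch D.tree w v).ncard ?_ ⟨v, w, hw, h, rfl⟩
    rw [← hm]
    exact Set.ncard_lt_ncard (branch_ssubset hT huv hw hwu)

/-! ### Existence of branch decompositions -/

/-- A parent function along which a rank decreases defines a tree. -/
theorem isTree_fromRel_parent {N : Type*} [Finite N] (par : N → N) (r : N) (rank : N → ℕ)
    (hrank : ∀ x, x ≠ r → rank (par x) < rank x) (hr : par r = r) :
    (SimpleGraph.fromRel fun x y => par x = y).IsTree := by
  set T := SimpleGraph.fromRel fun x y => par x = y with hTdef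
  have hroot : ∀ m x, rank x = m → T.Reachable x r := by
    intro m
    induction m using Nat.strong_induction_on with
    | _ m ih =>
      intro x hx
      by_cases hxr : x = r
      · rw [hxr]
      · have h := hrank x hxr
        have hadj : T.Adj x (par x) := by
          rw [hTdef, fromRel_adj]
          exact ⟨fun he => by rw [← he] at h; exact lt_irrefl _ h, Or.inl rfl⟩
        exact hadj.reachable.trans (ih _ (hx ▸ h) _ rfl)
  have : Nonempty N := ⟨r⟩
  have hconn : T.Connected :=
    ⟨fun x y => (hroot _ x rfl).trans (hroot _ y rfl).symm⟩
  rw [isTree_iff_connected_and_card]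
  refine ⟨hconn, le_antisymm ?_ hconn.card_vert_le_card_edgeSet_add_one⟩
  -- Every edge joins a non-root vertex to its parent, so there are fewer edges than vertices.
  have hsub : T.edgeSet ⊆ (fun x => s(x, par x)) '' {r}ᶜ := by
    intro e he
    induction e with
    | _ x y =>
      rw [mem_edgeSet, hTdef, fromRel_adj] at he
      rcases he with ⟨hne, rfl | rfl⟩
      · exact ⟨x, fun h => hne (by rw [Set.mem_singleton_iff.1 h, hr]), rfl⟩
      · exact ⟨y, fun h => hne (by rw [Set.mem_singleton_iff.1 h, hr]), Sym2.eq_swap⟩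
  have h1 := Set.ncard_le_ncard hsub
  have h2 := Set.ncard_image_le (f := fun x => s(x, par x)) (s := ({r}ᶜ : Set N))
  have h3 := Set.ncard_add_ncard_compl {r}
  rw [Set.ncard_singleton] at h3
  rw [Nat.card_coe_set_eq]
  omega

/-- The parent function of the caterpillar with `n + 2` leaves: the leaf `(i, true)` hangs at the
spine vertex `(i, false)`. -/
def caterpillarParent (n : ℕ) : Fin (n + 2) × Bool → Fin (n + 2) × Bool
  | (i, true) => (i, false)
  | (i, false) => (⟨i - 1, by omega⟩, false)

/-- Needed because `sInf ∅ = 0` in `ℕ`: a lower bound on `simWidth` requires some decomposition to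
exist. -/
theorem nonempty_branchDecomposition [Finite V] (hV : 2 ≤ Nat.card V) :
    Nonempty (BranchDecomposition V) := by
  obtain ⟨n, hn⟩ := Nat.exists_eq_add_of_le' hV
  set T := SimpleGraph.fromRel fun x y => caterpillarParent n x = y with hT
  have htree : T.IsTree := by
    -- The rank is the distance to the root `(0, false)`, which is its own parent since `0 - 1 = 0`
    -- in `ℕ`.
    refine isTree_fromRel_parent _ (0, false) (fun x => (x.1 : ℕ) + if x.2 then 1 else 0) ?_ ?_
    · rintro ⟨i, _ | _⟩ h
      · have : (i : ℕ) ≠ 0 := fun h0 => h (by ext <;> simp [h0])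
        simp [caterpillarParent]
        exact Nat.pos_of_ne_zero this
      · simp [caterpillarParent]
    · rfl
  have hup : ∀ i, T.neighborSet (i, true) ⊆ {(i, false)} := by
    rintro i ⟨j, _ | _⟩ h <;>
      simp_all [caterpillarParent, fromRel_adj, Fin.ext_iff]
  -- The truncations at both ends of the spine only add harmless elements to this superset.
  have hdown : ∀ i : Fin (n + 2), T.neighborSet (i, false) ⊆
      (({(i, true), (⟨i - 1, by omega⟩, false), (⟨min (i + 1) (n + 1), by omega⟩, false)} :
        Finset (Fin (n + 2) × Bool)) : Set (Fin (n + 2) × Bool)) := by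
    rintro i ⟨j, _ | _⟩ h
    · simp_all [caterpillarParent, fromRel_adj, Fin.ext_iff]
      omega
    · simp_all [caterpillarParent, fromRel_adj, Fin.ext_iff]
  have hleaf : ∀ i, IsLeaf T (i, true) := fun i => by
    have := Set.ncard_le_ncard (hup i)
    rwa [Set.ncard_singleton] at this
  have hspine : ∀ i, ¬ IsLeaf T (i, false) := by
    intro i hi
    have h1 : T.Adj (i, false) (i, true) := by
      simp [hT, caterpillarParent, fromRel_adj]
    have h2 : ∃ j, T.Adj (i, false) (j, false) := by
      by_cases h0 : (i : ℕ) = 0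
      · exact ⟨⟨1, by omega⟩, by simp [hT, caterpillarParent, fromRel_adj, Fin.ext_iff, h0]⟩
      · refine ⟨⟨i - 1, by omega⟩, ?_⟩
        simp [hT, caterpillarParent, fromRel_adj, Fin.ext_iff]
        omega
    obtain ⟨j, h2⟩ := h2
    have := (Set.ncard_le_one).1 hi _ h1 _ h2
    simp at this
  refine ⟨{
    Node := Fin (n + 2) × Bool
    finite_node := inferInstance
    tree := T
    isTree := htree
    subcubic := ?_
    leafEquiv := ((Finite.equivFin V).trans (finCongr hn)).trans
      { toFun := fun i => ⟨(i, true), hleaf i⟩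
        invFun := fun t => t.1.1
        left_inv := fun i => rfl
        right_inv := ?_ } }⟩
  · rintro ⟨i, _ | _⟩
    · refine (Set.ncard_le_ncard (hdown i)).trans ?_
      rw [Set.ncard_coe_finset]
      exact Finset.card_le_three
    · exact (hleaf i).trans (by norm_num)
  · rintro ⟨⟨i, _ | _⟩, h⟩
    · exact absurd h (hspine i)
    · rfl

/-! ### Lower bounds on `cutSim` and `simWidth` -/

/-- Without a bound, `sSup` in `ℕ` would take the default value `0`. -/
theorem bddAbove_cutSim [Finite V] (G : SimpleGraph V) (A : Set V) :
    BddAbove {m : ℕ | ∃ M : Finset (Sym2 V), IsInducedMatching G M ∧ Crosses M A ∧ M.card = m} := by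
  have := Fintype.ofFinite V
  classical
  refine ⟨Fintype.card (Sym2 V), ?_⟩
  rintro m ⟨M, -, -, rfl⟩
  exact M.card_le_univ

/-- Indexed form of an induced crossing matching; the conditions on `y i` against `x j` follow by
exchanging `i` and `j`. -/
theorem card_le_cutSim [Finite V] {ι : Type*} {G : SimpleGraph V} {A : Set V} (s : Finset ι)
    (x y : ι → V) (hadj : ∀ i ∈ s, G.Adj (x i) (y i)) (hsep : ∀ i ∈ s, ¬ (x i ∈ A ↔ y i ∈ A))
    (hind : ∀ i ∈ s, ∀ j ∈ s, i ≠ j → x i ≠ x j ∧ x i ≠ y j ∧ y i ≠ y j ∧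
      ¬ G.Adj (x i) (x j) ∧ ¬ G.Adj (x i) (y j) ∧ ¬ G.Adj (y i) (y j)) :
    s.card ≤ cutSim G A := by
  classical
  refine le_csSup (bddAbove_cutSim G A)
    ⟨s.image fun i => s(x i, y i), ⟨?_, ?_⟩, ?_, Finset.card_image_of_injOn ?_⟩
  · simpa using hadj
  · intro e he f hf hef a ha b hb
    obtain ⟨i, hi, rfl⟩ := Finset.mem_image.1 he
    obtain ⟨j, hj, rfl⟩ := Finset.mem_image.1 hf
    have hij : i ≠ j := fun h => hef (by rw [h])
    obtain ⟨h1, h2, h3, h4, h5, h6⟩ := hind i hi j hj hij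
    obtain ⟨-, h2', -, -, h5', -⟩ := hind j hj i hi hij.symm
    rcases Sym2.mem_iff.1 ha with rfl | rfl <;> rcases Sym2.mem_iff.1 hb with rfl | rfl
    · exact ⟨h1, h4⟩
    · exact ⟨h2, h5⟩
    · exact ⟨h2'.symm, fun h => h5' h.symm⟩
    · exact ⟨h3, h6⟩
  · intro e he
    obtain ⟨i, hi, rfl⟩ := Finset.mem_image.1 he
    have := hsep i hi
    by_cases hx : x i ∈ A
    · exact ⟨x i, y i, hx, by tauto, rfl⟩
    · exact ⟨y i, x i, by tauto, hx, Sym2.eq_swap⟩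
  · intro i hi j hj hij
    by_contra hne
    obtain ⟨h1, h2, -⟩ := hind i hi j hj hne
    rcases Sym2.eq_iff.1 hij with ⟨h, -⟩ | ⟨h, -⟩
    · exact h1 h
    · exact h2 h

theorem cutSim_side_le_simWidth (D : BranchDecomposition V) (G : SimpleGraph V) {u v : D.Node}
    (huv : D.tree.Adj u v) : cutSim G (D.side u v) ≤ D.simWidth G := by
  have := D.finite_node
  refine le_csSup (Set.Finite.bddAbove ?_) ⟨u, v, huv, rfl⟩
  refine (Set.finite_range fun p : D.Node × D.Node => cutSim G (D.side p.1 p.2)).subset ?_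
  rintro w ⟨u, v, -, rfl⟩
  exact ⟨(u, v), rfl⟩

/-- If every cut with `cutSim` at most `k` has at most `c` elements of `P` on one of its sides, and
`P` has more than `3 * c + 1` elements, then the sim-width exceeds `k`. -/
theorem lt_simWidth [Finite V] (G : SimpleGraph V) {P : Set V} {c k : ℕ} (hP : 3 * c + 1 < P.ncard)
    (hcut : ∀ A : Set V, cutSim G A ≤ k → (A ∩ P).ncard ≤ c ∨ (Aᶜ ∩ P).ncard ≤ c) :
    k < simWidth G := by
  have hV : 2 ≤ Nat.card V := by
    have := Set.ncard_le_card P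
    omega
  obtain ⟨D₀⟩ := nonempty_branchDecomposition hV
  obtain ⟨D, hD⟩ := Nat.sInf_mem (s := {w : ℕ | ∃ D : BranchDecomposition V, D.simWidth G = w})
    ⟨_, D₀, rfl⟩
  obtain ⟨u, v, huv, h1, h2⟩ := D.exists_balanced hP
  have h3 := cutSim_side_le_simWidth D G huv
  rw [simWidth, ← hD]
  by_contra! hle
  rcases hcut _ (h3.trans hle) with h | h <;> omega

/-! ### Complete bipartite graphs with a three-edge path attached to every edge -/

/-- The vertices of the complete bipartite graph `K_{n,n}` (`a i` and `b j`) and of the path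
`a i, q i j, p i j, b j` attached to its edge from `a i` to `b j`. -/
inductive EarVertex (n : ℕ) : Type
  | a (i : Fin n)
  | b (j : Fin n)
  | q (i j : Fin n)
  | p (i j : Fin n)

namespace EarVertex

variable {n : ℕ}

instance : Finite (EarVertex n) := by
  refine Finite.of_injective (β := (Fin n ⊕ Fin n) ⊕ (Fin n × Fin n) ⊕ (Fin n × Fin n))
    (fun x => match x with
      | a i => .inl (.inl i)
      | b j => .inl (.inr j)
      | q i j => .inr (.inl (i, j))
      | p i j => .inr (.inr (i, j))) ?_
  rintro (_ | _ | _ | _) (_ | _ | _ | _) h <;> simp_all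

/-- Adjacency from the class of the vertices `a i` and `p i j` to that of the `b j` and `q i j`. -/
def Joins : EarVertex n → EarVertex n → Prop
  | a _, b _ => True
  | a i, q i' _ => i = i'
  | p i j, q i' j' => i = i' ∧ j = j'
  | p _ j, b j' => j = j'
  | _, _ => False

end EarVertex

open EarVertex

/-- The complete bipartite graph `K_{n,n}` with a path of three edges attached to every edge. -/
def earGraph (n : ℕ) : SimpleGraph (EarVertex n) where
  Adj x y := Joins x y ∨ Joins y x
  symm := ⟨fun _ _ h => h.symm⟩
  loopless := ⟨by rintro (_ | _ | _ | _) h <;> simp [Joins] at h⟩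

variable {n : ℕ}

theorem earGraph_adj {x y : EarVertex n} : (earGraph n).Adj x y ↔ Joins x y ∨ Joins y x := Iff.rfl

/-! ### Induced cycles of the ear graph -/

theorem isBipartite_earGraph (n : ℕ) : (earGraph n).IsBipartite := by
  refine ⟨Coloring.mk (fun x => match x with
    | a _ => 0
    | p _ _ => 0
    | b _ => 1
    | q _ _ => 1) ?_⟩
  rintro (_ | _ | _ | _) (_ | _ | _ | _) h <;> simp_all [earGraph_adj, Joins]

/-- The neighbours of `p i j` are `q i j` and `b j`, and the only other neighbour of `q i j` is `a
i`, which is adjacent to `b j`. The two alternatives are the two directions of travel. -/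
theorem earGraph_adj_of_walk_p {x₀ x₁ x₃ x₄ : EarVertex n} {i j : Fin n}
    (h₀ : (earGraph n).Adj x₀ x₁) (h₁ : (earGraph n).Adj x₁ (p i j))
    (h₂ : (earGraph n).Adj (p i j) x₃) (h₃ : (earGraph n).Adj x₃ x₄)
    (h02 : x₀ ≠ p i j) (h13 : x₁ ≠ x₃) (h24 : p i j ≠ x₄) :
    (earGraph n).Adj x₀ x₃ ∨ (earGraph n).Adj x₁ x₄ := by
  rcases x₁ with _ | _ | _ | _ <;> simp [earGraph_adj, Joins] at h₁ <;>
  rcases x₃ with _ | _ | _ | _ <;> simp [earGraph_adj, Joins] at h₂ <;>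
  rcases x₀ with _ | _ | _ | _ <;> simp [earGraph_adj, Joins] at h₀ <;>
  rcases x₄ with _ | _ | _ | _ <;> simp [earGraph_adj, Joins] at h₃ <;>
  simp_all [earGraph_adj, Joins]

/-- Mirror image: beyond `p i j` the walk must go to `b j`, which is adjacent to `a i`. -/
theorem earGraph_adj_of_walk_q {x₀ x₁ x₃ x₄ : EarVertex n} {i j : Fin n}
    (h₀ : (earGraph n).Adj x₀ x₁) (h₁ : (earGraph n).Adj x₁ (q i j))
    (h₂ : (earGraph n).Adj (q i j) x₃) (h₃ : (earGraph n).Adj x₃ x₄)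
    (h02 : x₀ ≠ q i j) (h13 : x₁ ≠ x₃) (h24 : q i j ≠ x₄) :
    (earGraph n).Adj x₀ x₃ ∨ (earGraph n).Adj x₁ x₄ := by
  rcases x₁ with _ | _ | _ | _ <;> simp [earGraph_adj, Joins] at h₁ <;>
  rcases x₃ with _ | _ | _ | _ <;> simp [earGraph_adj, Joins] at h₂ <;>
  rcases x₀ with _ | _ | _ | _ <;> simp [earGraph_adj, Joins] at h₀ <;>
  rcases x₄ with _ | _ | _ | _ <;> simp [earGraph_adj, Joins] at h₃ <;>
  simp_all [earGraph_adj, Joins]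

/-- A cyclic sequence in the graph without immediate reversals has two adjacent entries at
distance three. -/
theorem exists_earGraph_adj_add_three {Z : Type*} [AddCommGroup Z] (c : Z) (f : Z → EarVertex n)
    (hadj : ∀ t, (earGraph n).Adj (f t) (f (t + c))) (hne : ∀ t, f t ≠ f (t + c + c)) :
    ∃ t, (earGraph n).Adj (f t) (f (t + c + c + c)) := by
  by_contra! hcon
  have hnot : ∀ t, ¬ ((earGraph n).Adj (f t) (f (t + c + c + c)) ∨
      (earGraph n).Adj (f (t + c)) (f (t + c + c + c + c))) := fun t => by
    have := hcon t
    have := hcon (t + c)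
    tauto
  have hp : ∀ t i j, f t ≠ p i j := by
    intro t i j h
    -- Recentre, so that the ear vertex is the middle of five consecutive entries.
    obtain ⟨s, rfl⟩ : ∃ s, t = s + c + c := ⟨t - c - c, by abel⟩
    have h0 := hadj s
    have h1 := hadj (s + c)
    have h2 := hadj (s + c + c)
    have h3 := hadj (s + c + c + c)
    have n0 := hne s
    have n1 := hne (s + c)
    have n2 := hne (s + c + c)
    rw [h] at h1 h2 n0 n2
    exact hnot s (earGraph_adj_of_walk_p h0 h1 h2 h3 n0 n1 n2)
  have hq : ∀ t i j, f t ≠ q i j := by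
    intro t i j h
    obtain ⟨s, rfl⟩ : ∃ s, t = s + c + c := ⟨t - c - c, by abel⟩
    have h0 := hadj s
    have h1 := hadj (s + c)
    have h2 := hadj (s + c + c)
    have h3 := hadj (s + c + c + c)
    have n0 := hne s
    have n1 := hne (s + c)
    have n2 := hne (s + c + c)
    rw [h] at h1 h2 n0 n2
    exact hnot s (earGraph_adj_of_walk_q h0 h1 h2 h3 n0 n1 n2)
  -- With no ear vertices left the sequence alternates between the sides of `K_{n,n}`, so entries at
  -- distance three are adjacent.
  have key : ∀ x₀ x₁ x₂ x₃ : EarVertex n, (∀ i j, x₀ ≠ p i j) → (∀ i j, x₀ ≠ q i j) →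
      (∀ i j, x₁ ≠ p i j) → (∀ i j, x₁ ≠ q i j) → (∀ i j, x₂ ≠ p i j) → (∀ i j, x₂ ≠ q i j) →
      (∀ i j, x₃ ≠ p i j) → (∀ i j, x₃ ≠ q i j) → (earGraph n).Adj x₀ x₁ →
      (earGraph n).Adj x₁ x₂ → (earGraph n).Adj x₂ x₃ → (earGraph n).Adj x₀ x₃ := by
    rintro (_ | _ | _ | _) (_ | _ | _ | _) (_ | _ | _ | _) (_ | _ | _ | _) <;>
      simp [earGraph_adj, Joins]
  exact hcon 0 (key _ _ _ _ (hp _) (hq _) (hp _) (hq _) (hp _) (hq _) (hp _) (hq _) (hadj _)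
    (hadj _) (hadj _))

theorem isChordalBipartite_earGraph (n : ℕ) : IsChordalBipartite (earGraph n) := by
  refine ⟨isBipartite_earGraph n, ?_⟩
  rintro m hm ⟨f⟩
  obtain ⟨m, rfl⟩ := Nat.exists_eq_add_of_le' (show 2 ≤ m by omega)
  obtain ⟨t, ht⟩ := exists_earGraph_adj_add_three (1 : Fin (m + 2)) f
    (fun t => f.map_rel_iff.2 (by simp [cycleGraph_adj]))
    (fun t h => by
      have h' := f.injective h
      rw [add_assoc, left_eq_add, Fin.ext_iff, Fin.val_add] at h'
      simp at h'
      rw [Nat.mod_eq_of_lt (by omega)] at h'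
      omega)
  -- Adjacency at distance three in the cycle means `3 = -1` or `3 = 1` modulo its length `m + 2 ≥
  -- 3`; only length four allows this.
  have h3 := f.map_rel_iff.1 ht
  rw [cycleGraph_adj, add_assoc, add_assoc, sub_add_cancel_left, add_sub_cancel_left] at h3
  have e3 : ((1 + (1 + 1) : Fin (m + 2)) : ℕ) = 3 % (m + 2) := by
    simp [Fin.val_add]
  rcases h3 with h3 | h3
  · have : (1 + (1 + 1)) + (1 : Fin (m + 2)) = 0 := neg_eq_iff_add_eq_zero.1 h3
    rw [Fin.ext_iff, Fin.val_add, e3] at this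
    simp at this
    have hle := Nat.le_of_dvd (by norm_num) (Nat.dvd_of_mod_eq_zero this)
    have : m ≤ 2 := by omega
    interval_cases m <;> simp_all
  · rw [Fin.ext_iff, e3] at h3
    simp at h3
    rcases Nat.lt_or_ge 3 (m + 2) with h | h
    · rw [Nat.mod_eq_of_lt h] at h3
      omega
    · obtain rfl : m = 1 := by omega
      omega

/-! ### Cuts of the ear graph with small `cutSim` -/

/-- The vertices `p i j`. -/
def innerVertices (n : ℕ) : Set (EarVertex n) := Set.range fun z : Fin n × Fin n => p z.1 z.2

theorem ncard_innerVertices (n : ℕ) : (innerVertices n).ncard = n * n := by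
  rw [innerVertices, ← Set.image_univ, Set.ncard_image_of_injective, Set.ncard_univ]
  · simp
  · rintro ⟨i, j⟩ ⟨i', j'⟩ h
    simpa using h

open Classical in
/-- The indices `i` such that the cut `A` separates `a i` from some `q i j`. -/
noncomputable def splitRows (A : Set (EarVertex n)) : Finset (Fin n) :=
  {i | ∃ j, ¬ (a i ∈ A ↔ q i j ∈ A)}

open Classical in
/-- The indices `j` such that the cut `A` separates `b j` from some `p i j`. -/
noncomputable def splitColumns (A : Set (EarVertex n)) : Finset (Fin n) :=
  {j | ∃ i, ¬ (b j ∈ A ↔ p i j ∈ A)}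

open Classical in
/-- The pairs `(i, j)` such that the cut `A` separates `q i j` from `p i j`. -/
noncomputable def splitPairs (A : Set (EarVertex n)) : Finset (Fin n × Fin n) :=
  {z | ¬ (q z.1 z.2 ∈ A ↔ p z.1 z.2 ∈ A)}

/-- One separated edge `a i`–`q i j` per split row gives an induced matching, as `q i j` has no
neighbour among the other `a i'` or among the `q`. -/
theorem card_splitRows_le (A : Set (EarVertex n)) :
    (splitRows A).card ≤ cutSim (earGraph n) A := by
  -- The implication sits under `∃ j` so that `φ` is total; in an unsplit row its value is
  -- arbitrary.
  have h : ∀ i, ∃ j, i ∈ splitRows A → ¬ (a i ∈ A ↔ q i j ∈ A) := fun i => by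
    by_cases hi : ∃ j, ¬ (a i ∈ A ↔ q i j ∈ A)
    · exact ⟨hi.choose, fun _ => hi.choose_spec⟩
    · exact ⟨i, fun h => absurd (by simpa [splitRows] using h) hi⟩
  choose φ hφ using h
  exact card_le_cutSim _ (fun i => a i) (fun i => q i (φ i))
    (fun i _ => by simp [earGraph_adj, Joins]) hφ
    (fun i _ j _ hij => by simp [earGraph_adj, Joins, hij])

theorem card_splitColumns_le (A : Set (EarVertex n)) :
    (splitColumns A).card ≤ cutSim (earGraph n) A := by
  have h : ∀ j, ∃ i, j ∈ splitColumns A → ¬ (b j ∈ A ↔ p i j ∈ A) := fun j => by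
    by_cases hj : ∃ i, ¬ (b j ∈ A ↔ p i j ∈ A)
    · exact ⟨hj.choose, fun _ => hj.choose_spec⟩
    · exact ⟨j, fun h => absurd (by simpa [splitColumns] using h) hj⟩
  choose φ hφ using h
  exact card_le_cutSim _ (fun j => b j) (fun j => p (φ j) j)
    (fun j _ => by simp [earGraph_adj, Joins]) hφ
    (fun i _ j _ hij => by simp [earGraph_adj, Joins, hij, hij.symm])

theorem card_splitPairs_le (A : Set (EarVertex n)) :
    (splitPairs A).card ≤ cutSim (earGraph n) A :=
  card_le_cutSim _ (fun z => q z.1 z.2) (fun z => p z.1 z.2)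
    (fun z _ => by simp [earGraph_adj, Joins]) (fun z hz => by simpa [splitPairs] using hz)
    (fun z _ w _ hzw => by
      have h : ¬ (z.1 = w.1 ∧ z.2 = w.2) := fun h => hzw (Prod.ext h.1 h.2)
      have h' : ¬ (w.1 = z.1 ∧ w.2 = z.2) := fun h => hzw (Prod.ext h.1.symm h.2.symm)
      simp [earGraph_adj, Joins, h, h'])

/-- If `b j` and `b j'` were separated, then in each unsplit row `i` the vertices `q i j` and `q i
j'` would lie with `a i`, while `p i j` and `p i j'` would lie on opposite sides, so one of the two
ears is split. That gives at least `n - k` split ears, more than `k`. -/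
theorem mem_iff_of_not_mem_splitColumns {A : Set (EarVertex n)} {k : ℕ} (hk : 2 * k < n)
    (hA : cutSim (earGraph n) A ≤ k) {j j' : Fin n} (hj : j ∉ splitColumns A)
    (hj' : j' ∉ splitColumns A) : b j ∈ A ↔ b j' ∈ A := by
  classical
  by_contra hne
  have h : ∀ i ∈ (splitRows A)ᶜ, ∃ z ∈ splitPairs A, z.1 = i := by
    intro i hi
    simp only [splitRows, splitColumns, Finset.mem_compl, Finset.mem_filter, Finset.mem_univ,
      true_and, not_exists, not_not] at hi hj hj'
    have h1 := hi j
    have h2 := hi j'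
    have h3 := hj i
    have h4 := hj' i
    by_cases h5 : q i j ∈ A ↔ p i j ∈ A
    · refine ⟨(i, j'), ?_, rfl⟩
      simp only [splitPairs, Finset.mem_filter, Finset.mem_univ, true_and]
      tauto
    · exact ⟨(i, j), by simpa [splitPairs] using h5, rfl⟩
  have hsub : (splitRows A)ᶜ ⊆ (splitPairs A).image Prod.fst := fun i hi =>
    Finset.mem_image.2 (h i hi)
  have h1 := (Finset.card_le_card hsub).trans Finset.card_image_le
  have h2 := card_splitPairs_le A
  have h3 := card_splitRows_le A
  rw [Finset.card_compl, Fintype.card_fin] at h1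
  omega

/-- Used with `B` equal to `A` or `Aᶜ`, whichever meets the `p i j` in split columns only: at most
`k` columns of `n` vertices each. -/
theorem ncard_inter_innerVertices_le {A B : Set (EarVertex n)} {k : ℕ}
    (hA : cutSim (earGraph n) A ≤ k) (hB : ∀ i j, j ∉ splitColumns A → p i j ∉ B) :
    (B ∩ innerVertices n).ncard ≤ k * n := by
  classical
  have hsub : B ∩ innerVertices n ⊆
      (fun z : Fin n × Fin n => p z.2 z.1) ''
        ↑(splitColumns A ×ˢ Finset.univ : Finset (Fin n × Fin n)) := by
    rintro _ ⟨hx, ⟨i, j⟩, rfl⟩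
    refine ⟨(j, i), ?_, rfl⟩
    by_contra hj
    exact hB i j (by simpa using hj) hx
  have h1 := Set.ncard_le_ncard hsub
  have h2 := Set.ncard_image_le (f := fun z : Fin n × Fin n => p z.2 z.1)
    (s := ((splitColumns A ×ˢ Finset.univ : Finset (Fin n × Fin n)) : Set (Fin n × Fin n)))
  rw [Set.ncard_coe_finset, Finset.card_product, Finset.card_univ, Fintype.card_fin] at h2
  exact (h1.trans h2).trans (Nat.mul_le_mul_right n ((card_splitColumns_le A).trans hA))

theorem ncard_inter_innerVertices_le_or {A : Set (EarVertex n)} {k : ℕ} (hk : 2 * k < n)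
    (hA : cutSim (earGraph n) A ≤ k) :
    (A ∩ innerVertices n).ncard ≤ k * n ∨ (Aᶜ ∩ innerVertices n).ncard ≤ k * n := by
  have hcol : ∀ i j, j ∉ splitColumns A → (b j ∈ A ↔ p i j ∈ A) := by
    intro i j hj
    simp only [splitColumns, Finset.mem_filter, Finset.mem_univ, true_and, not_exists,
      not_not] at hj
    exact hj i
  by_cases h : ∃ j, j ∉ splitColumns A ∧ b j ∈ A
  · obtain ⟨j, hj, hjA⟩ := h
    refine Or.inr (ncard_inter_innerVertices_le hA fun i j' hj' hp => hp ?_)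
    exact (hcol i j' hj').1 ((mem_iff_of_not_mem_splitColumns hk hA hj hj').1 hjA)
  · push Not at h
    exact Or.inl (ncard_inter_innerVertices_le hA fun i j hj hp =>
      h j hj ((hcol i j hj).2 hp))

theorem lt_simWidth_earGraph (k : ℕ) : k < simWidth (earGraph (3 * k + 2)) := by
  refine lt_simWidth (earGraph (3 * k + 2)) (P := innerVertices (3 * k + 2))
    (c := k * (3 * k + 2)) ?_ fun A hA => ncard_inter_innerVertices_le_or (by omega) hA
  rw [ncard_innerVertices]
  -- With `n = 3 * k + 2`, `n * n = 3 * (k * n) + 2 * n`, which exceeds `3 * (k * n) + 1`.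
  nlinarith

end SimWidth

theorem mainTheorem11 :
    ∀ k : ℕ, ∃ (V : Type) (_ : Finite V) (G : SimpleGraph V),
      SimWidth.IsChordalBipartite G ∧ k < SimWidth.simWidth G := by
  exact fun k => ⟨SimWidth.EarVertex (3 * k + 2), inferInstance, SimWidth.earGraph (3 * k + 2),
    SimWidth.isChordalBipartite_earGraph _, SimWidth.lt_simWidth_earGraph k⟩
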